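/- Let $(X,\dim,D)$ be a Lefschetz complex over $\mathbb Z_2$: $X$ is a finite set of cells, $\dim:X\to\mathbb N$, $D:X\times X\to\mathbb Z_2$, where $D(x,y)\neq 0$ implies $\dim x+1=\dim y$, and $\sum_z D(x,z)D(z,y)=0$ for all $x,y$. A discrete Morse function (dMf) is a map $h:X\to\mathbb R$ such that $D(x,y)=1$ implies $h(x)\le h(y)$; if $x\ne y$ and $h(x)=h(y)$ then $D(x,y)=1$ or $D(y,x)=1$; and $|h^{-1}(r)|\le 2$ for every $r\in\mathbb R$. The $h$-order is: $x<_h y$ iff $h(x)<h(y)$, or $h(x)=h(y)$ and $\dim x<\dim y$. A vector of $h$ is a set $\{x,y\}$ with $D(x,y)=1$ and $h(x)=h(y)$. The lazy reduction of a $\mathbb Z_2$-matrix $M$ with ordered rows and columns starts with $R=M$, $U=I$ and processes the columns $y$ from left to right: while $R[:,y]\ne 0$ and some preceding column $x$ has the same low (index of the lowest nonzero entry) as $y$, add $R[:,x]$ to $R[:,y]$ and add $U[y,:]$ to $U[x,:]$. Let $D_n$ be the matrix of $D$ with the $(n-1)$-cells as rows and the $n$-cells as columns, both in the $h$-order, and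 let $D_n=R_nU_n$ be its lazy reduction. Let $D^\perp_n$ be the matrix with entries $D^\perp_n[y,x]=D(x,y)$, with the $(n+1)$-cells $y$ as rows and the $n$-cells $x$ as columns, both in the reversed $h$-order, and let $D_n^\perp=R_n^\perp U_n^\perp$ be its lazy reduction. Let $\mathrm{BD}(h)$ be the set of birth-death pairs $\alpha=(b_\alpha,d_\alpha)$: either $b_\alpha$ is the low of the column $d_\alpha$ of $R_n$, $n=\dim d_\alpha$, or $b_\alpha$ is a homology generator (its column in the reduced boundary matrix is zero and it is the low of no column) and $d_\alpha$ is undefined. For cells $x,y$ of the same dimension $n$, write $x\xrightarrow{\times}y$ if $U_n[x,y]=1$ and $x\xrightarrow{\circ}y$ if $U_n^\perp[x,y]=1$. For pairs, write $\beta\xrightarrow{\times}\alpha$ if $d_\beta$ is defined and $d_\beta\xrightarrow{\times}c$ for some component $c$ of $\alpha$, and $\beta\xrightarrow{\circ}\alpha$ if $b_\beta\xrightarrow{\circ}c$ for some component $c$ of $\alpha$. Let $h,h'$ be dMfs on $X$ such that the $h'$-order arises from the $h$-order by a transposition of two adjacent blocks $A,B\subseteq X$, each of which is a single cell or a vector of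 $h$: every cell of $A$ precedes every cell of $B$ in the $h$-order and follows it in the $h'$-order, and the relative order of all other pairs of cells is the same in both orders. Assume that the transposition causes no switch in the pairing, that is, $\mathrm{BD}(h')=\mathrm{BD}(h)$. **Proposition.** Let $\alpha\in\mathrm{BD}(h)$, of any dimension, and suppose that the transposition moves $b_\alpha$ up in the order ($b_\alpha\in A$) or moves $d_\alpha$ down in the order ($d_\alpha$ is defined and $d_\alpha\in B$). Then no relation into $\alpha$ of either type is created: for every $\beta\in\mathrm{BD}(h)$, if $\beta\xrightarrow{\times}\alpha$ holds for $h'$ then it holds for $h$, and if $\beta\xrightarrow{\circ}\alpha$ holds for $h'$ then it holds for $h$. -/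

import Mathlib

/-- A Lefschetz complex with coefficients in `ℤ/2` on the finite set of cells `X`. -/
structure LefschetzComplex (X : Type*) [Fintype X] where
  /-- the dimension of a cell -/
  dim : X → ℕ
  /-- the boundary coefficient; `x` is a facet of `y` when `D x y ≠ 0` -/
  D : X → X → ZMod 2
  dim_of_ne_zero : ∀ x y, D x y ≠ 0 → dim x + 1 = dim y
  sum_mul_eq_zero : ∀ x y, ∑ z, D x z * D z y = 0

/-! ### Lazy reduction of a matrix over `ℤ/2`

Rows and columns are ordered by strict orders `rlt` and `clt`. -/

section Reduction

variable {ι κ : Type*}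

/-- `i` is the index of the lowest nonzero entry of the column `v`, that is, the largest index
in the row order `rlt` whose entry is nonzero. A zero column has no low. -/
def IsLow (rlt : ι → ι → Prop) (v : ι → ZMod 2) (i : ι) : Prop :=
  v i ≠ 0 ∧ ∀ j, v j ≠ 0 → j = i ∨ rlt j i

/-- Guard of the inner loop: the column `y` is nonzero, and `x` is a preceding column with the
same low. -/
def Conflict (rlt : ι → ι → Prop) (clt : κ → κ → Prop) (R : Matrix ι κ (ZMod 2))
    (x y : κ) : Prop :=
  clt x y ∧ ∃ i, IsLow rlt (fun r => R r x) i ∧ IsLow rlt (fun r => R r y) i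

open Classical in
/-- One pass of the inner loop for the column `y`, acting on the pair `(R, U)`: if a preceding
column `x` has the same low as `y`, add the column `x` of `R` to the column `y` of `R`, and add
the row `y` of `U` to the row `x` of `U`; if there is none, the loop has ended and nothing
changes. -/
noncomputable def lazyStep (rlt : ι → ι → Prop) (clt : κ → κ → Prop) (y : κ)
    (S : Matrix ι κ (ZMod 2) × Matrix κ κ (ZMod 2)) :
    Matrix ι κ (ZMod 2) × Matrix κ κ (ZMod 2) :=
  if hx : ∃ x, Conflict rlt clt S.1 x y then
    (fun i z => if z = y then S.1 i y + S.1 i hx.choose else S.1 i z,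
      fun w z => if w = hx.choose then S.2 w z + S.2 y z else S.2 w z)
  else S

/-- The inner `while` loop for the column `y`. Each effective pass moves the low of `y` strictly
up or makes the column zero, so the loop has ended after at most as many passes as there are
rows, and further passes do nothing. -/
noncomputable def lazyColumn [Fintype ι] (rlt : ι → ι → Prop) (clt : κ → κ → Prop)
    (S : Matrix ι κ (ZMod 2) × Matrix κ κ (ZMod 2)) (y : κ) :
    Matrix ι κ (ZMod 2) × Matrix κ κ (ZMod 2) :=
  (lazyStep rlt clt y)^[Fintype.card ι] S

open Classical in
/-- All columns, listed from left to right. -/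
noncomputable def columnList [Fintype κ] (clt : κ → κ → Prop) : List κ :=
  (Finset.univ : Finset κ).toList.insertionSort (fun x y => x = y ∨ clt x y)

open Classical in
/-- The lazy reduction of `M`: starting from `R = M` and `U = 1`, process the columns from left to
right. The output is the pair `(R, U)`. -/
noncomputable def lazyReduction [Fintype ι] [Fintype κ] (rlt : ι → ι → Prop)
    (clt : κ → κ → Prop) (M : Matrix ι κ (ZMod 2)) :
    Matrix ι κ (ZMod 2) × Matrix κ κ (ZMod 2) :=
  (columnList clt).foldl (lazyColumn rlt clt) (M, fun x y => if x = y then 1 else 0)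

end Reduction

namespace LefschetzComplex

variable {X : Type*} [Fintype X] (K : LefschetzComplex X)

/-- Discrete Morse functions on a Lefschetz complex. -/
structure IsDiscreteMorse (h : X → ℝ) : Prop where
  weakly_monotone : ∀ x y, K.D x y = 1 → h x ≤ h y
  pairing : ∀ x y, x ≠ y → h x = h y → K.D x y = 1 ∨ K.D y x = 1
  almost_injective : ∀ r : ℝ, {x | h x = r}.ncard ≤ 2

/-- The `h`-order on the cells. -/
def hlt (h : X → ℝ) (x y : X) : Prop :=
  h x < h y ∨ (h x = h y ∧ K.dim x < K.dim y)

/-- The boundary matrix `D_n`: its rows are the `(n-1)`-cells, its columns the `n`-cells. For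
`n = 0` there are no rows. -/
def boundaryMatrix (n : ℕ) : Matrix {x // K.dim x + 1 = n} {y // K.dim y = n} (ZMod 2) :=
  fun x y => K.D x y

/-- The coboundary matrix `Dᗮ_n`: its rows are the `(n+1)`-cells, its columns the `n`-cells. -/
def coboundaryMatrix (n : ℕ) : Matrix {y // K.dim y = n + 1} {x // K.dim x = n} (ZMod 2) :=
  fun y x => K.D x y

/-- The output `(R_n, U_n)` of the lazy reduction of `D_n`, rows and columns in the `h`-order. -/
noncomputable def homReduction (h : X → ℝ) (n : ℕ) :
    Matrix {x // K.dim x + 1 = n} {y // K.dim y = n} (ZMod 2) ×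
      Matrix {y // K.dim y = n} {y // K.dim y = n} (ZMod 2) :=
  lazyReduction (fun x y => K.hlt h x y) (fun x y => K.hlt h x y) (K.boundaryMatrix n)

/-- The output `(Rᗮ_n, Uᗮ_n)` of the lazy reduction of `Dᗮ_n`, rows and columns in the reversed
`h`-order. -/
noncomputable def cohomReduction (h : X → ℝ) (n : ℕ) :
    Matrix {y // K.dim y = n + 1} {x // K.dim x = n} (ZMod 2) ×
      Matrix {x // K.dim x = n} {x // K.dim x = n} (ZMod 2) :=
  lazyReduction (fun x y => K.hlt h y x) (fun x y => K.hlt h y x) (K.coboundaryMatrix n)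

/-- `b` is the low of the column `d` of the reduced boundary matrix. -/
def IsPaired (h : X → ℝ) (b d : X) : Prop :=
  ∃ (n : ℕ) (hb : K.dim b + 1 = n) (hd : K.dim d = n),
    IsLow (fun x y : {x // K.dim x + 1 = n} => K.hlt h x y)
      (fun r => (K.homReduction h n).1 r ⟨d, hd⟩) ⟨b, hb⟩

/-- A homology generator: its column in the reduced boundary matrix is zero, and it is the low of
no column. -/
def IsGenerator (h : X → ℝ) (b : X) : Prop :=
  (∀ r, (K.homReduction h (K.dim b)).1 r ⟨b, rfl⟩ = 0) ∧ ∀ d, ¬ K.IsPaired h b d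

/-- The set of birth-death pairs. A pair consists of its birth cell and its death cell; a homology
generator is regarded as the birth cell of a pair whose death cell is undefined (`none`). -/
def bd (h : X → ℝ) : Set (X × Option X) :=
  {α | (∃ d, α.2 = some d ∧ K.IsPaired h α.1 d) ∨ (α.2 = none ∧ K.IsGenerator h α.1)}

/-- Homological relation between cells of the same dimension: `U_n[x, y] = 1`. -/
def CellHomRel (h : X → ℝ) (x y : X) : Prop :=
  ∃ (n : ℕ) (hx : K.dim x = n) (hy : K.dim y = n), (K.homReduction h n).2 ⟨x, hx⟩ ⟨y, hy⟩ = 1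

/-- Cohomological relation between cells of the same dimension: `Uᗮ_n[x, y] = 1`. -/
def CellCohomRel (h : X → ℝ) (x y : X) : Prop :=
  ∃ (n : ℕ) (hx : K.dim x = n) (hy : K.dim y = n), (K.cohomReduction h n).2 ⟨x, hx⟩ ⟨y, hy⟩ = 1

/-- Homological relation from the pair `β` to the pair `α`: the death cell of `β` is homologically
related to a component of `α`. -/
def PairHomRel (h : X → ℝ) (β α : X × Option X) : Prop :=
  ∃ d, β.2 = some d ∧ ∃ c, (c = α.1 ∨ α.2 = some c) ∧ K.CellHomRel h d c

/-- Cohomological relation from the pair `β` to the pair `α`: the birth cell of `β` is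
cohomologically related to a component of `α`. -/
def PairCohomRel (h : X → ℝ) (β α : X × Option X) : Prop :=
  ∃ c, (c = α.1 ∨ α.2 = some c) ∧ K.CellCohomRel h β.1 c

/-- A block of cells that can be moved at once: a single cell, or a vector of the combinatorial
vector field of `h`, that is, a facet-cofacet pair with equal values. -/
def IsBlock (h : X → ℝ) (A : Set X) : Prop :=
  (∃ x, A = {x}) ∨ ∃ x y, K.D x y = 1 ∧ h x = h y ∧ A = {x, y}

/-- The `h'`-order arises from the `h`-order by one transposition: the block `A`, which precedes
the block `B` in the `h`-order, follows `B` in the `h'`-order, and the relative order of all other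
pairs of cells is the same. This forces the blocks to be disjoint and to be adjacent in both
orders. -/
structure IsTransposition (h h' : X → ℝ) (A B : Set X) : Prop where
  left_block : K.IsBlock h A
  right_block : K.IsBlock h B
  swap : ∀ a ∈ A, ∀ b ∈ B, K.hlt h a b ∧ K.hlt h' b a
  keep : ∀ x y, ¬ (x ∈ A ∧ y ∈ B) → ¬ (x ∈ B ∧ y ∈ A) → (K.hlt h x y ↔ K.hlt h' x y)

end LefschetzComplex

/-! The lazy reduction adds a column x to a column y only when their lows agree, and the low of y
then moves strictly up or the column vanishes. So `U x y ≠ 0` with `x ≠ y` forces the low of x to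
lie strictly below the whole reduced column y. Together with M = RU, unitriangularity of U and
distinctness of the lows, this determines the output (`IsLazyReduction`). The argument localizes: if
two reductions of M have the same lows, and their row orders agree on a set T of rows closed under
passing to later rows, then `U x y` is the same for both whenever x has its low in T
(`coeff_eq_and_column_eq`).

The transposition affects the row order only if there are rows i₀ ∈ A and i₁ ∈ B. Suppose the column
j has low i₀. A new coefficient `U' x j` comes from a column x whose low follows i₀ in the new
order, hence lies beyond both blocks, where the orders agree; so the coefficient was already there.
An old coefficient from the column with low i₁ can disappear, which is why only creation is
excluded. If instead j itself belongs to a block containing a row, the two cells form a vector. Its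
cofacet directly follows its facet, so the column j needs no reduction. These cases make up
`coeff_ne_zero_of_transposition`.

Applied to the boundary matrix, this gives the homological relations. For the cohomological ones it
is applied to the coboundary matrix, where reversal of the order exchanges A and B. The assumption
on BD carries over because both reductions have the same pairs (`isLow_transpose_iff`). -/

/-- `r` is a strict total order. -/
structure StrictTotal {ι : Type*} (r : ι → ι → Prop) : Prop where
  irrefl : ∀ i, ¬ r i i
  trans : ∀ i j k, r i j → r j k → r i k
  total : ∀ i j, i = j ∨ r i j ∨ r j i

namespace StrictTotal

variable {ι : Type*} {r : ι → ι → Prop}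

theorem asymm (h : StrictTotal r) {i j : ι} (h₁ : r i j) (h₂ : r j i) : False :=
  h.irrefl i (h.trans _ _ _ h₁ h₂)

theorem swap (h : StrictTotal r) : StrictTotal (fun i j => r j i) where
  irrefl := h.irrefl
  trans := fun _ _ _ h₁ h₂ => h.trans _ _ _ h₂ h₁
  total := fun i j => (h.total i j).imp id Or.symm

theorem wellFounded [Finite ι] (h : StrictTotal r) : WellFounded r := by
  have : IsStrictOrder ι r := { irrefl := h.irrefl, trans := h.trans }
  exact Finite.wellFounded_of_trans_of_irrefl r

theorem exists_greatest [Finite ι] (h : StrictTotal r) (s : Set ι) (hs : s.Nonempty) :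
    ∃ i ∈ s, ∀ j ∈ s, j = i ∨ r j i := by
  obtain ⟨i, hi, hmax⟩ := h.swap.wellFounded.has_min s hs
  refine ⟨i, hi, fun j hj => ?_⟩
  rcases h.total j i with e | e | e
  · exact Or.inl e
  · exact Or.inr e
  · exact (hmax j hj e).elim

end StrictTotal

/-! ### Lows and linear independence -/

section Low

variable {ι κ : Type*} {r : ι → ι → Prop}

theorem IsLow.unique (hr : StrictTotal r) {v : ι → ZMod 2} {i j : ι} (hi : IsLow r v i)
    (hj : IsLow r v j) : i = j := by
  rcases hj.2 i hi.1 with e | e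
  · exact e
  · rcases hi.2 j hj.1 with e' | e'
    · exact e'.symm
    · exact (hr.asymm e e').elim

theorem exists_isLow [Finite ι] (hr : StrictTotal r) {v : ι → ZMod 2} {i : ι} (hi : v i ≠ 0) :
    ∃ l, IsLow r v l := by
  obtain ⟨l, hl, hmax⟩ := hr.exists_greatest {k | v k ≠ 0} ⟨i, hi⟩
  exact ⟨l, hl, hmax⟩

/-- Columns with distinct lows are linearly independent, in a form that only looks at the entries
of the combination at these lows. -/
theorem eq_zero_of_sum_eq_zero_at_lows [Finite ι] [Fintype κ] (hr : StrictTotal r)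
    {R : Matrix ι κ (ZMod 2)}
    (hinj : ∀ x y i, IsLow r (fun k => R k x) i → IsLow r (fun k => R k y) i → x = y)
    (e : κ → ZMod 2)
    (he : ∀ x, e x ≠ 0 → ∃ i, IsLow r (fun k => R k x) i ∧ ∑ z, e z * R i z = 0) (x : κ) :
    e x = 0 := by
  by_contra hx
  obtain ⟨i, ⟨x, hx, hxi⟩, hmax⟩ := hr.exists_greatest
    {i | ∃ x, e x ≠ 0 ∧ IsLow r (fun k => R k x) i} ⟨(he x hx).choose, x, hx, (he x hx).choose_spec.1⟩
  obtain ⟨i', hi', hsum⟩ := he x hx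
  obtain rfl := hi'.unique hr hxi
  rw [Finset.sum_eq_single x] at hsum
  · exact mul_ne_zero hx hxi.1 hsum
  · intro z _ hz
    by_contra hne
    have h1 : e z ≠ 0 := left_ne_zero_of_mul hne
    have h2 : R i' z ≠ 0 := right_ne_zero_of_mul hne
    obtain ⟨j, hj, -⟩ := he z h1
    rcases hmax j ⟨z, h1, hj⟩ with rfl | hji
    · exact hz (hinj _ _ _ hj hxi)
    · rcases hj.2 i' h2 with rfl | h3
      · exact hr.irrefl _ hji
      · exact hr.asymm hji h3
  · simp

end Low

/-! ### Uniqueness and locality of the lazy reduction -/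

/-- The properties that determine the output of the lazy reduction. -/
structure IsLazyReduction {ι κ : Type*} [Fintype κ] (r : ι → ι → Prop) (c : κ → κ → Prop)
    (M R : Matrix ι κ (ZMod 2)) (U : Matrix κ κ (ZMod 2)) : Prop where
  sum_eq : ∀ i y, ∑ x, U x y * R i x = M i y
  diag : ∀ y, U y y = 1
  lt_of_ne_zero : ∀ x y, x ≠ y → U x y ≠ 0 → c x y
  low_of_ne_zero : ∀ x y, x ≠ y → U x y ≠ 0 →
    ∃ i, IsLow r (fun k => R k x) i ∧ ∀ k, R k y ≠ 0 → r k i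
  low_injective : ∀ x y i, IsLow r (fun k => R k x) i → IsLow r (fun k => R k y) i → x = y

namespace IsLazyReduction

variable {ι κ : Type*} [Finite ι] [Fintype κ] {r r' : ι → ι → Prop} {c c' : κ → κ → Prop}
  {M R R' : Matrix ι κ (ZMod 2)} {U U' : Matrix κ κ (ZMod 2)}

omit [Finite ι] in
theorem exists_sum_eq_add (H : IsLazyReduction r c M R U) (i : ι) (y : κ) :
    ∃ s : ZMod 2, M i y = R i y + s ∧ (s ≠ 0 → ∃ x, x ≠ y ∧ U x y ≠ 0 ∧ R i x ≠ 0) := by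
  classical
  refine ⟨∑ x ∈ Finset.univ.erase y, U x y * R i x, ?_, fun hs => ?_⟩
  · rw [← H.sum_eq, ← Finset.add_sum_erase _ _ (Finset.mem_univ y), H.diag, one_mul]
  · obtain ⟨x, hx, hne⟩ := Finset.exists_ne_zero_of_sum_ne_zero hs
    exact ⟨x, Finset.ne_of_mem_erase hx, left_ne_zero_of_mul hne, right_ne_zero_of_mul hne⟩

/-- The entries of `U` are determined by the lows and by the order of the rows below them. -/
theorem coeff_eq_and_column_eq (hr : StrictTotal r) (hr' : StrictTotal r') (hc' : StrictTotal c')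
    (H : IsLazyReduction r c M R U) (H' : IsLazyReduction r' c' M R' U')
    (hlow : ∀ i j, IsLow r (fun k => R k j) i ↔ IsLow r' (fun k => R' k j) i)
    (T : Set ι) (hTup : ∀ k ∈ T, ∀ l, r k l → l ∈ T) (hT : ∀ k ∈ T, ∀ l, r k l ↔ r' k l)
    (y : κ) :
    (∀ x, ∀ i ∈ T, IsLow r (fun k => R k x) i → U x y = U' x y) ∧
      (∀ i ∈ T, IsLow r (fun k => R k y) i → ∀ k, R k y = R' k y) := by
  classical
  induction y using hc'.wellFounded.induction with
  | _ y ih =>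
  have part1 : ∀ x, ∀ i ∈ T, IsLow r (fun k => R k x) i → U x y = U' x y := by
    -- The difference of the two coefficient columns, cut down to lows in T and without the
    -- diagonal; it is shown to be a vanishing combination at the relevant lows.
    set e : κ → ZMod 2 := fun x =>
      if (∃ i ∈ T, IsLow r (fun k => R k x) i) ∧ x ≠ y then U x y - U' x y else 0 with he
    have key : ∀ x, e x = 0 := by
      refine eq_zero_of_sum_eq_zero_at_lows hr H.low_injective e fun x hx => ?_
      have hx1 : (∃ i ∈ T, IsLow r (fun k => R k x) i) ∧ x ≠ y := by
        by_contra h; simp only [he, if_neg h, ne_eq, not_true] at hx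
      have hx2 : U x y - U' x y ≠ 0 := by
        simpa only [he, if_pos hx1] using hx
      obtain ⟨⟨i, hiT, hi⟩, hxy⟩ := hx1
      refine ⟨i, hi, ?_⟩
      have hi' := (hlow _ _).1 hi
      -- One coefficient is nonzero, so one reduced column y lies strictly above i. As lows and
      -- order agree on T, so does the other.
      have hboth : R i y = 0 ∧ R' i y = 0 := by
        rcases (show U x y ≠ 0 ∨ U' x y ≠ 0 by
          by_contra h; push Not at h; exact hx2 (by rw [h.1, h.2, sub_zero])) with h | h
        · obtain ⟨j, hj, hsupp⟩ := H.low_of_ne_zero x y hxy h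
          obtain rfl := hj.unique hr hi
          refine ⟨by_contra fun h0 => hr.irrefl _ (hsupp _ h0), by_contra fun h0 => ?_⟩
          obtain ⟨l, hl⟩ := exists_isLow hr' (v := fun k => R' k y) h0
          have := hsupp l ((hlow _ _).2 hl).1
          rcases hl.2 j h0 with rfl | h3
          · exact hr.irrefl _ this
          · exact hr.asymm this ((hT _ hiT _).2 h3)
        · obtain ⟨j, hj, hsupp⟩ := H'.low_of_ne_zero x y hxy h
          obtain rfl := hj.unique hr' hi'
          refine ⟨by_contra fun h0 => ?_, by_contra fun h0 => hr'.irrefl _ (hsupp _ h0)⟩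
          obtain ⟨l, hl⟩ := exists_isLow hr (v := fun k => R k y) h0
          have := hsupp l ((hlow _ _).1 hl).1
          rcases hl.2 j h0 with rfl | h3
          · exact hr'.irrefl _ this
          · exact hr'.asymm this ((hT _ hiT _).1 h3)
      have hterm : ∀ z, e z * R i z = U z y * R i z - U' z y * R' i z := by
        intro z
        by_cases hzy : z = y
        · subst hzy
          simp [hboth.1, hboth.2]
        by_cases hz : ∃ i ∈ T, IsLow r (fun k => R k z) i
        · have : e z = U z y - U' z y := by simp only [he]; exact if_pos ⟨hz, hzy⟩
          rw [this, sub_mul]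
          -- The reduced columns z need to agree only if `U' z y ≠ 0`; then z precedes y for c' and
          -- induction applies.
          by_cases hU : U' z y = 0
          · simp [hU]
          · obtain ⟨j, hjT, hj⟩ := hz
            rw [(ih z (H'.lt_of_ne_zero z y hzy hU)).2 j hjT hj i]
        -- A contributing column with low outside T has no entry in row i, since T contains every
        -- row from i on.
        · have : e z = 0 := by simp only [he]; exact if_neg fun h => hz h.1
          have h1 : U z y * R i z = 0 := by
            by_contra hne
            obtain ⟨j, hj, -⟩ := H.low_of_ne_zero z y hzy (left_ne_zero_of_mul hne)
            rcases hj.2 i (right_ne_zero_of_mul hne) with rfl | h3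
            · exact hz ⟨_, hiT, hj⟩
            · exact hz ⟨_, hTup _ hiT _ h3, hj⟩
          have h2 : U' z y * R' i z = 0 := by
            by_contra hne
            obtain ⟨j, hj, -⟩ := H'.low_of_ne_zero z y hzy (left_ne_zero_of_mul hne)
            rcases hj.2 i (right_ne_zero_of_mul hne) with rfl | h3
            · exact hz ⟨_, hiT, (hlow _ _).2 hj⟩
            · exact hz ⟨_, hTup _ hiT _ ((hT _ hiT _).2 h3), (hlow _ _).2 hj⟩
          rw [this, h1, h2, zero_mul, sub_zero]
      rw [Finset.sum_congr rfl fun z _ => hterm z, Finset.sum_sub_distrib, H.sum_eq, H'.sum_eq,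
        sub_self]
    intro x i hiT hi
    by_cases hxy : x = y
    · rw [hxy, H.diag, H'.diag]
    · have := key x
      rw [he] at this
      simp only [if_pos (show (∃ i ∈ T, IsLow r (fun k => R k x) i) ∧ x ≠ y from
        ⟨⟨i, hiT, hi⟩, hxy⟩)] at this
      exact sub_eq_zero.1 this
  -- If y has its low in T, every column added to y has a later low, again in T. So the first part
  -- compares all the coefficients involved.
  refine ⟨part1, fun l hlT hl k => ?_⟩
  have h1 := H.sum_eq k y
  have h2 := H'.sum_eq k y
  rw [← Finset.add_sum_erase _ _ (Finset.mem_univ y), H.diag, one_mul] at h1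
  rw [← Finset.add_sum_erase _ _ (Finset.mem_univ y), H'.diag, one_mul] at h2
  have h3 : ∑ x ∈ Finset.univ.erase y, U x y * R k x =
      ∑ x ∈ Finset.univ.erase y, U' x y * R' k x := by
    refine Finset.sum_congr rfl fun x hx => ?_
    have hxy := Finset.ne_of_mem_erase hx
    by_cases hU : U x y = 0
    · have hU' : U' x y = 0 := by
        by_contra h
        obtain ⟨j, hj, hsupp⟩ := H'.low_of_ne_zero x y hxy h
        have hlj := (hT _ hlT _).2 (hsupp l ((hlow _ _).1 hl).1)
        exact h ((part1 x j (hTup _ hlT _ hlj) ((hlow _ _).2 hj)).symm.trans hU)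
      rw [hU, hU', zero_mul, zero_mul]
    · obtain ⟨j, hj, hsupp⟩ := H.low_of_ne_zero x y hxy hU
      have hjT := hTup _ hlT _ (hsupp l hl.1)
      have hU' := part1 x j hjT hj
      rw [hU'] at hU
      rw [hU', (ih x (H'.lt_of_ne_zero x y hxy hU)).2 j hjT hj k]
  rw [h3] at h1
  exact add_right_cancel (h1.trans h2.symm)

omit [Finite ι] in
/-- A set that contains the support of the columns to the left of `y` and of `y` itself in `M`
contains the support of the reduced column. -/
theorem column_support (hc : StrictTotal c) (H : IsLazyReduction r c M R U)
    (S : ι → κ → Prop) (hM : ∀ i y, M i y ≠ 0 → S i y) (hS : ∀ i x y, S i x → c x y → S i y)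
    (i : ι) (y : κ) (hy : R i y ≠ 0) : S i y := by
  induction y using hc.wellFounded.induction with
  | _ y ih =>
  obtain ⟨s, hs, hs'⟩ := H.exists_sum_eq_add i y
  by_cases h0 : s = 0
  · exact hM _ _ (by rwa [hs, h0, add_zero])
  · obtain ⟨x, hxy, hU, hRx⟩ := hs' h0
    have := H.lt_of_ne_zero x y hxy hU
    exact hS _ _ _ (ih x this hRx) this

omit [Finite ι] in
/-- The column of a cofacet that directly follows its paired facet is not changed by the
reduction. -/
theorem eq_of_coeff_ne_zero_of_adjacent {X : Type*} {lt : X → X → Prop}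
    (htrans : ∀ x y z, lt x y → lt y z → lt x z) {f : ι → X} {g : κ → X}
    (hc : StrictTotal c) (hrf : ∀ i j, r i j → lt (f i) (f j)) (hcg : ∀ i j, c i j → lt (g i) (g j))
    (hM : ∀ i j, M i j ≠ 0 → lt (f i) (g j))
    (H : IsLazyReduction r c M R U) {i : ι} {j : κ} (hij : M i j ≠ 0)
    (hadj : ∀ z, lt (f i) z → ¬ lt z (g j)) {x : κ} (hx : U x j ≠ 0) : x = j := by
  have hsupp : ∀ i y, R i y ≠ 0 → lt (f i) (g y) :=
    H.column_support hc _ hM fun i x y h1 h2 => htrans _ _ _ h1 (hcg _ _ h2)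
  -- Cancelling this entry would take a column lying strictly between i and j.
  have hRij : R i j ≠ 0 := by
    obtain ⟨s, hs, hs'⟩ := H.exists_sum_eq_add i j
    by_cases h0 : s = 0
    · rw [h0, add_zero] at hs
      rwa [← hs]
    · obtain ⟨z, hz, hU, hRz⟩ := hs' h0
      exact (hadj (g z) (hsupp _ _ hRz) (hcg _ _ (H.lt_of_ne_zero z j hz hU))).elim
  by_contra hxj
  obtain ⟨k, hk, hk'⟩ := H.low_of_ne_zero x j hxj hx
  exact hadj (g x) (htrans _ _ _ (hrf _ _ (hk' i hRij)) (hsupp _ _ hk.1))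
    (hcg _ _ (H.lt_of_ne_zero x j hxj hx))

end IsLazyReduction

/-! ### Duality between a matrix and its anti-transpose -/

namespace IsLazyReduction

variable {ι κ : Type*} [Fintype ι] [Fintype κ] {r : ι → ι → Prop} {c : κ → κ → Prop}
  {M R : Matrix ι κ (ZMod 2)} {U : Matrix κ κ (ZMod 2)}

omit [Fintype ι] in
/-- The reduced columns are unitriangular combinations of the original ones. -/
theorem exists_combination (hc : StrictTotal c) (H : IsLazyReduction r c M R U) (y : κ) :
    ∃ v : κ → ZMod 2, v y = 1 ∧ (∀ x, v x ≠ 0 → x = y ∨ c x y) ∧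
      ∀ i, R i y = ∑ x, M i x * v x := by
  classical
  induction y using hc.wellFounded.induction with
  | _ y ih =>
  choose! v hv1 hv2 hv3 using ih
  refine ⟨fun z => (if z = y then 1 else 0) - ∑ x ∈ Finset.univ.erase y, U x y * v x z,
    ?_, ?_, ?_⟩
  · simp only [if_true]
    rw [Finset.sum_eq_zero, sub_zero]
    intro x hx
    by_contra hne
    have hxy := Finset.ne_of_mem_erase hx
    have hcx := H.lt_of_ne_zero x y hxy (left_ne_zero_of_mul hne)
    rcases hv2 x hcx y (right_ne_zero_of_mul hne) with h | h
    · exact hxy h.symm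
    · exact hc.asymm h hcx
  · intro z hz
    by_cases hzy : z = y
    · exact Or.inl hzy
    right
    dsimp only at hz
    rw [if_neg hzy, zero_sub, neg_ne_zero] at hz
    obtain ⟨x, hx, hne⟩ := Finset.exists_ne_zero_of_sum_ne_zero hz
    have hxy := Finset.ne_of_mem_erase hx
    have hcx := H.lt_of_ne_zero x y hxy (left_ne_zero_of_mul hne)
    rcases hv2 x hcx z (right_ne_zero_of_mul hne) with h | h
    · exact h ▸ hcx
    · exact hc.trans _ _ _ h hcx
  · intro i
    have h1 := H.sum_eq i y
    rw [← Finset.add_sum_erase _ _ (Finset.mem_univ y), H.diag, one_mul] at h1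
    rw [eq_sub_of_add_eq h1]
    simp only [mul_sub, Finset.sum_sub_distrib, Finset.mul_sum]
    congr 1
    · simp
    · rw [Finset.sum_comm]
      refine Finset.sum_congr rfl fun x hx => ?_
      by_cases hU : U x y = 0
      · simp [hU]
      · rw [hv3 x (H.lt_of_ne_zero x y (Finset.ne_of_mem_erase hx) hU), Finset.mul_sum]
        exact Finset.sum_congr rfl fun z _ => by ring

/-- A low of the reduced matrix is also a low of the reduced anti-transpose. -/
theorem isLow_transpose_of_isLow (hr : StrictTotal r) (hc : StrictTotal c)
    (H : IsLazyReduction r c M R U) {R' : Matrix κ ι (ZMod 2)} {U' : Matrix ι ι (ZMod 2)}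
    (H' : IsLazyReduction (fun x y => c y x) (fun i j => r j i) M.transpose R' U')
    {i : ι} {j : κ} (hij : IsLow r (fun k => R k j) i) :
    IsLow (fun x y => c y x) (fun x => R' x i) j := by
  induction j using hc.wellFounded.induction generalizing i with
  | _ j ih =>
  choose v hv1 hv2 hv3 using H.exists_combination hc
  choose w hw1 hw2 hw3 using H'.exists_combination hr.swap
  -- Both sides are the bilinear form M evaluated at the combinations w i and v j.
  have hpair : ∀ i j, ∑ k, w i k * R k j = ∑ x, R' x i * v j x := by
    intro i j
    simp only [hv3, hw3, Finset.mul_sum, Finset.sum_mul]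
    rw [Finset.sum_comm]
    refine Finset.sum_congr rfl fun x _ => Finset.sum_congr rfl fun k _ => ?_
    rw [Matrix.transpose_apply]
    ring
  -- The support of w i starts at i and that of the reduced column j ends at i, so a single term
  -- survives.
  have h1 : ∑ k, w i k * R k j ≠ 0 := by
    rw [Finset.sum_eq_single i, hw1, one_mul]
    · exact hij.1
    · intro k _ hk
      by_contra hne
      rcases hw2 i k (left_ne_zero_of_mul hne) with h | h
      · exact hk h
      · rcases hij.2 k (right_ne_zero_of_mul hne) with h' | h'
        · exact hk h'
        · exact hr.asymm h h'
    · simp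
  rw [hpair] at h1
  obtain ⟨x, -, hx⟩ := Finset.exists_ne_zero_of_sum_ne_zero h1
  obtain ⟨j', hj'⟩ := exists_isLow hc.swap (v := fun x => R' x i) (left_ne_zero_of_mul hx)
  have hj'j : j' = j ∨ c j' j := by
    rcases hv2 j x (right_ne_zero_of_mul hx) with h | h <;>
      rcases hj'.2 x (left_ne_zero_of_mul hx) with h' | h'
    · exact Or.inl (h'.symm.trans h)
    · exact Or.inr (h ▸ h')
    · exact Or.inr (h' ▸ h)
    · exact Or.inr (hc.trans _ _ _ h' h)
  rcases hj'j with rfl | hlt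
  · exact hj'
  -- If j' preceded j, the dual evaluation would make the column j' of R nonzero; by induction its
  -- low would be i, which is already the low of j.
  have h2 : ∑ x, R' x i * v j' x ≠ 0 := by
    rw [Finset.sum_eq_single j', hv1, mul_one]
    · exact hj'.1
    · intro x _ hx
      by_contra hne
      rcases hv2 j' x (right_ne_zero_of_mul hne) with h | h
      · exact hx h
      · rcases hj'.2 x (left_ne_zero_of_mul hne) with h' | h'
        · exact hx h'
        · exact hc.asymm h h'
    · simp
  rw [← hpair] at h2
  obtain ⟨k, -, hk⟩ := Finset.exists_ne_zero_of_sum_ne_zero h2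
  obtain ⟨i', hi'⟩ := exists_isLow hr (v := fun k => R k j') (right_ne_zero_of_mul hk)
  obtain rfl := H'.low_injective _ _ _ (ih j' hlt hi') hj'
  exact (hc.irrefl _ (H.low_injective _ _ _ hi' hij ▸ hlt)).elim

theorem isLow_transpose_iff (hr : StrictTotal r) (hc : StrictTotal c)
    (H : IsLazyReduction r c M R U) {R' : Matrix κ ι (ZMod 2)} {U' : Matrix ι ι (ZMod 2)}
    (H' : IsLazyReduction (fun x y => c y x) (fun i j => r j i) M.transpose R' U')
    (i : ι) (j : κ) :
    IsLow r (fun k => R k j) i ↔ IsLow (fun x y => c y x) (fun x => R' x i) j :=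
  ⟨H.isLow_transpose_of_isLow hr hc H', H'.isLow_transpose_of_isLow hc.swap hr.swap H⟩

end IsLazyReduction

/-! ### The algorithm -/

section Algorithm

variable {ι κ : Type*} {r : ι → ι → Prop} {c : κ → κ → Prop}

/-- The state of the algorithm when the columns in `P` have been reduced. -/
structure PartialReduction [Fintype κ] (r : ι → ι → Prop) (c : κ → κ → Prop)
    (M : Matrix ι κ (ZMod 2)) (P : Set κ) (S : Matrix ι κ (ZMod 2) × Matrix κ κ (ZMod 2)) :
    Prop where
  sum_eq : ∀ i y, ∑ x, S.2 x y * S.1 i x = M i y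
  diag : ∀ y, S.2 y y = 1
  lt_of_ne_zero : ∀ x y, x ≠ y → S.2 x y ≠ 0 → c x y ∧ x ∈ P
  low_of_ne_zero : ∀ x y, x ≠ y → S.2 x y ≠ 0 →
    ∃ i, IsLow r (fun k => S.1 k x) i ∧ ∀ k, S.1 k y ≠ 0 → r k i
  low_injective : ∀ x ∈ P, ∀ y ∈ P, ∀ i, IsLow r (fun k => S.1 k x) i →
    IsLow r (fun k => S.1 k y) i → x = y

/-- The rows on or above the low of the column `y`. -/
def rowsToLow (r : ι → ι → Prop) (R : Matrix ι κ (ZMod 2)) (y : κ) : Set ι :=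
  {k | ∃ l, R l y ≠ 0 ∧ (k = l ∨ r k l)}

variable [Fintype ι] [Fintype κ] {M : Matrix ι κ (ZMod 2)} {P : Set κ}
  {S : Matrix ι κ (ZMod 2) × Matrix κ κ (ZMod 2)}

theorem zmod_two_eq_one {a : ZMod 2} (h : a ≠ 0) : a = 1 := by
  revert a; decide

omit [Fintype ι] [Fintype κ] in
theorem lazyStep_eq_self {y : κ} (h : ¬ ∃ x, Conflict r c S.1 x y) : lazyStep r c y S = S := by
  rw [lazyStep, dif_neg h]

/-- Over ℤ/2 the two lowest entries cancel, so the low of y moves strictly up. This gives both the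
low condition on the new coefficient and the decrease of the termination measure. -/
theorem PartialReduction.lazyStep (hr : StrictTotal r) (hc : StrictTotal c)
    (H : PartialReduction r c M P S) {y : κ} (hy : y ∉ P) (hP : ∀ x, c x y → x ∈ P) :
    PartialReduction r c M P (lazyStep r c y S) ∧
      ((∃ x, Conflict r c S.1 x y) →
        (rowsToLow r (_root_.lazyStep r c y S).1 y).ncard < (rowsToLow r S.1 y).ncard) := by
  classical
  by_cases hx : ∃ x, Conflict r c S.1 x y
  swap
  · rw [lazyStep_eq_self hx]
    exact ⟨H, fun h => (hx h).elim⟩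
  have hstep : _root_.lazyStep r c y S =
      (fun i z => if z = y then S.1 i y + S.1 i hx.choose else S.1 i z,
        fun w z => if w = hx.choose then S.2 w z + S.2 y z else S.2 w z) := by
    rw [_root_.lazyStep, dif_pos hx]
    congr
  obtain ⟨hcx, i, hix, hiy⟩ := hx.choose_spec
  generalize hx.choose = x at hstep hcx hix hiy
  have hxy : x ≠ y := fun h => hc.irrefl _ (h ▸ hcx)
  -- As y is unprocessed, its row of U is still an identity row, and adding it to row x changes only
  -- the entry (x, y).
  have hrow : ∀ z, z ≠ y → S.2 y z = 0 := fun z hz => by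
    by_contra h
    exact hy (H.lt_of_ne_zero y z hz.symm h).2
  -- Had x been added to y before, its low would lie strictly below the present low of y.
  have hUxy : S.2 x y = 0 := by
    by_contra h
    obtain ⟨j, hj, hs⟩ := H.low_of_ne_zero x y hxy h
    obtain rfl := hj.unique hr hix
    exact hr.irrefl _ (hs _ hiy.1)
  have hnew : ∀ k, S.1 k y + S.1 k x ≠ 0 → r k i := by
    intro k hk
    have hki : k ≠ i := by
      rintro rfl
      have h1 : S.1 k x = 1 := zmod_two_eq_one hix.1
      have h2 : S.1 k y = 1 := zmod_two_eq_one hiy.1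
      rw [h1, h2] at hk
      exact hk (by decide)
    by_cases h0 : S.1 k y = 0
    · rw [h0, zero_add] at hk
      exact (hix.2 k hk).resolve_left hki
    · exact (hiy.2 k h0).resolve_left hki
  rw [hstep]
  refine ⟨⟨?_, ?_, ?_, ?_, ?_⟩, fun _ => ?_⟩
  · intro k z
    rw [← H.sum_eq k z]
    by_cases hz : z = y
    · subst hz
      rw [← Finset.add_sum_erase _ _ (Finset.mem_univ z),
        ← Finset.add_sum_erase _ _ (Finset.mem_univ z),
        ← Finset.add_sum_erase _ _ (Finset.mem_erase.2 ⟨hxy, Finset.mem_univ x⟩),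
        ← Finset.add_sum_erase _ _ (Finset.mem_erase.2 ⟨hxy, Finset.mem_univ x⟩)]
      have hrest : ∀ w ∈ (Finset.univ.erase z).erase x,
          (if w = x then S.2 w z + S.2 z z else S.2 w z) *
            (if w = z then S.1 k z + S.1 k x else S.1 k w) = S.2 w z * S.1 k w := by
        intro w hw
        rw [if_neg (Finset.ne_of_mem_erase hw),
          if_neg (Finset.ne_of_mem_erase (Finset.mem_of_mem_erase hw))]
      dsimp only
      rw [Finset.sum_congr rfl hrest]
      simp only [if_true, if_neg hxy, if_neg hxy.symm, H.diag, hUxy]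
      have h2 : S.1 k x + S.1 k x = 0 := CharTwo.add_self_eq_zero _
      linear_combination h2
    · refine Finset.sum_congr rfl fun w _ => ?_
      dsimp only
      rw [hrow z hz, add_zero, ite_self]
      by_cases hw : w = y
      · rw [hw, hrow z hz, zero_mul, zero_mul]
      · rw [if_neg hw]
  · intro z
    dsimp only
    by_cases hz : z = x
    · subst hz
      rw [if_pos rfl, hrow z hxy, add_zero, H.diag]
    · rw [if_neg hz, H.diag]
  · intro w z hwz hne
    dsimp only at hne
    by_cases hw : w = x
    · subst hw
      by_cases hz : z = y
      · subst hz
        exact ⟨hcx, hP _ hcx⟩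
      · rw [hrow z hz, add_zero, ite_self] at hne
        exact H.lt_of_ne_zero _ _ hwz hne
    · rw [if_neg hw] at hne
      exact H.lt_of_ne_zero _ _ hwz hne
  · intro w z hwz hne
    dsimp only at hne ⊢
    by_cases hz : z = y
    · subst hz
      simp only [if_neg hwz, if_true]
      by_cases hw : w = x
      · subst hw
        exact ⟨i, hix, hnew⟩
      · rw [if_neg hw] at hne
        obtain ⟨j, hj, hs⟩ := H.low_of_ne_zero w z hwz hne
        exact ⟨j, hj, fun k hk => hr.trans _ _ _ (hnew k hk) (hs _ hiy.1)⟩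
    · rw [hrow z hz, add_zero, ite_self] at hne
      have hwy : w ≠ y := by
        rintro rfl
        exact hne (hrow z hz)
      simp only [if_neg hwy, if_neg hz]
      exact H.low_of_ne_zero w z hwz hne
  · intro w hw z hz j
    have hwy : w ≠ y := fun h => hy (h ▸ hw)
    have hzy : z ≠ y := fun h => hy (h ▸ hz)
    simp only [if_neg hwy, if_neg hzy]
    exact H.low_injective w hw z hz j
  · refine Set.ncard_lt_ncard ((Set.ssubset_iff_of_subset ?_).2 ⟨i, ⟨i, hiy.1, Or.inl rfl⟩, ?_⟩)
      (Set.toFinite _)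
    · rintro k ⟨l, hl, hkl⟩
      simp only [if_true] at hl
      refine ⟨i, hiy.1, Or.inr ?_⟩
      rcases hkl with rfl | hkl
      · exact hnew _ hl
      · exact hr.trans _ _ _ hkl (hnew _ hl)
    · rintro ⟨l, hl, hil⟩
      simp only [if_true] at hl
      rcases hil with rfl | hil
      · exact hr.irrefl _ (hnew _ hl)
      · exact hr.asymm hil (hnew _ hl)

theorem PartialReduction.iterate (hr : StrictTotal r) (hc : StrictTotal c) {y : κ} (hy : y ∉ P)
    (hP : ∀ x, c x y → x ∈ P) (n : ℕ) (S : Matrix ι κ (ZMod 2) × Matrix κ κ (ZMod 2))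
    (H : PartialReduction r c M P S) (hn : (rowsToLow r S.1 y).ncard ≤ n) :
    PartialReduction r c M P ((_root_.lazyStep r c y)^[n] S) ∧
      ¬ ∃ x, Conflict r c ((_root_.lazyStep r c y)^[n] S).1 x y := by
  induction n generalizing S with
  | zero =>
    refine ⟨H, ?_⟩
    rintro ⟨x, -, i, -, hi⟩
    have h0 : rowsToLow r S.1 y = ∅ := (Set.ncard_eq_zero (Set.toFinite _)).1 (Nat.le_zero.1 hn)
    exact (h0 ▸ (⟨i, hi.1, Or.inl rfl⟩ : i ∈ rowsToLow r S.1 y) : i ∈ (∅ : Set ι))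
  | succ n ih =>
    rw [Function.iterate_succ_apply]
    have h1 := H.lazyStep hr hc hy hP
    by_cases hx : ∃ x, Conflict r c S.1 x y
    · exact ih _ h1.1 (Nat.le_of_lt_succ ((h1.2 hx).trans_le hn))
    · have hfix : (_root_.lazyStep r c y)^[n] S = S :=
        Function.iterate_fixed (lazyStep_eq_self hx) n
      rw [lazyStep_eq_self hx, hfix]
      exact ⟨H, hx⟩

theorem PartialReduction.lazyColumn (hr : StrictTotal r) (hc : StrictTotal c) {y : κ} (hy : y ∉ P)
    (hP : ∀ x, c x y → x ∈ P) (hP' : ∀ x ∈ P, c x y) (H : PartialReduction r c M P S) :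
    PartialReduction r c M (insert y P) (lazyColumn r c S y) := by
  obtain ⟨h1, h2⟩ := H.iterate hr hc hy hP (Fintype.card ι) S
    ((Set.ncard_le_card _).trans (Nat.card_eq_fintype_card).le)
  refine ⟨h1.sum_eq, h1.diag, fun x z hxz hne =>
    (h1.lt_of_ne_zero x z hxz hne).imp id (Set.mem_insert_of_mem _), h1.low_of_ne_zero, ?_⟩
  rintro x (rfl | hx) z (rfl | hz) i hi hi'
  · rfl
  · exact (h2 ⟨z, hP' z hz, i, hi', hi⟩).elim
  · exact (h2 ⟨x, hP' x hx, i, hi, hi'⟩).elim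
  · exact h1.low_injective x hx z hz i hi hi'

theorem PartialReduction.foldl (hr : StrictTotal r) (hc : StrictTotal c) (L : List κ)
    (hL : L.Pairwise c) (H : PartialReduction r c M P S) (hPL : ∀ z, z ∈ P ∨ z ∈ L)
    (hlt : ∀ x ∈ P, ∀ z ∈ L, c x z) :
    PartialReduction r c M Set.univ (L.foldl (_root_.lazyColumn r c) S) := by
  induction L generalizing P S with
  | nil =>
    have : P = Set.univ := Set.eq_univ_of_forall fun z => (hPL z).resolve_right (by simp)
    exact this ▸ H
  | cons y L ih =>
    rw [List.pairwise_cons] at hL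
    rw [List.foldl_cons]
    refine ih hL.2 (H.lazyColumn hr hc (fun h => hc.irrefl _ (hlt y h y (by simp)))
      (fun x hx => (hPL x).resolve_right fun h => ?_) fun x hx => hlt x hx y (by simp)) ?_ ?_
    · rcases List.mem_cons.1 h with rfl | h
      · exact hc.irrefl _ hx
      · exact hc.asymm hx (hL.1 x h)
    · intro z
      rcases hPL z with h | h
      · exact Or.inl (Set.mem_insert_of_mem _ h)
      · rcases List.mem_cons.1 h with rfl | h
        · exact Or.inl (Set.mem_insert _ _)
        · exact Or.inr h
    · rintro x (rfl | hx) z hz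
      · exact hL.1 z hz
      · exact hlt x hx z (List.mem_cons_of_mem _ hz)

theorem mem_columnList (c : κ → κ → Prop) (x : κ) : x ∈ columnList c := by
  simp [columnList]

theorem pairwise_columnList (hc : StrictTotal c) : (columnList c).Pairwise c := by
  classical
  have : Std.Total (fun x y => x = y ∨ c x y) :=
    ⟨fun x y => by rcases hc.total x y with h | h | h <;> tauto⟩
  have : IsTrans κ (fun x y => x = y ∨ c x y) :=
    ⟨by
      rintro x y z (rfl | h) (rfl | h')
      · exact Or.inl rfl
      · exact Or.inr h'
      · exact Or.inr h
      · exact Or.inr (hc.trans _ _ _ h h')⟩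
  have h1 : (columnList c).Pairwise (fun x y => x = y ∨ c x y) := List.pairwise_insertionSort _ _
  have h2 : (columnList c).Nodup := (List.perm_insertionSort _ _).nodup_iff.2 (Finset.nodup_toList _)
  exact h1.imp₂ (fun _ _ h h' => h.resolve_left h') h2

theorem isLazyReduction_lazyReduction (hr : StrictTotal r) (hc : StrictTotal c)
    (M : Matrix ι κ (ZMod 2)) :
    IsLazyReduction r c M (lazyReduction r c M).1 (lazyReduction r c M).2 := by
  classical
  have h0 : PartialReduction r c M ∅ (M, fun x y => if x = y then 1 else 0) := by
    refine ⟨fun i y => ?_, fun y => if_pos rfl, fun x y hxy h => ?_, fun x y hxy h => ?_, ?_⟩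
    · simp
    · exact (h (if_neg hxy)).elim
    · exact (h (if_neg hxy)).elim
    · simp
  have h1 := h0.foldl hr hc (columnList c) (pairwise_columnList hc)
    (fun z => Or.inr (mem_columnList c z)) (by simp)
  have h2 : lazyReduction r c M =
      (columnList c).foldl (lazyColumn r c) (M, fun x y => if x = y then 1 else 0) := by
    rw [lazyReduction]
  rw [h2]
  exact ⟨h1.sum_eq, h1.diag, fun x y hxy h => (h1.lt_of_ne_zero x y hxy h).1, h1.low_of_ne_zero,
    fun x y => h1.low_injective x (Set.mem_univ _) y (Set.mem_univ _)⟩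

end Algorithm

/-! ### A single column under a transposition -/

namespace IsLazyReduction

/-- A transposition of two blocks that preserves the lows creates no coefficient in the column `j`
if `j` has its low in the first block, if it belongs to one of the blocks, or if the second block
contains no rows. -/
theorem coeff_ne_zero_of_transposition {X ι κ : Type*} [Finite ι] [Fintype κ]
    {lt lt' : X → X → Prop} {A B : Set X} {f : ι → X} {g : κ → X}
    (htrans' : ∀ x y z, lt' x y → lt' y z → lt' x z)
    (hr : StrictTotal (fun i k => lt (f i) (f k))) (hr' : StrictTotal (fun i k => lt' (f i) (f k)))
    (hc' : StrictTotal (fun i k => lt' (g i) (g k)))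
    {M R R' : Matrix ι κ (ZMod 2)} {U U' : Matrix κ κ (ZMod 2)}
    (H : IsLazyReduction (fun i k => lt (f i) (f k)) (fun i k => lt (g i) (g k)) M R U)
    (H' : IsLazyReduction (fun i k => lt' (f i) (f k)) (fun i k => lt' (g i) (g k)) M R' U')
    (hM' : ∀ i j, M i j ≠ 0 → lt' (f i) (g j))
    (hlow : ∀ i j, IsLow (fun i k => lt (f i) (f k)) (fun k => R k j) i ↔
      IsLow (fun i k => lt' (f i) (f k)) (fun k => R' k j) i)
    (swap : ∀ a ∈ A, ∀ b ∈ B, lt a b ∧ lt' b a)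
    (keep : ∀ x y, ¬ (x ∈ A ∧ y ∈ B) → ¬ (x ∈ B ∧ y ∈ A) → (lt x y ↔ lt' x y))
    (hA : ∀ i k, f i ∈ A → f k ∈ A → i = k) (hB : ∀ i k, f i ∈ B → f k ∈ B → i = k)
    (hadjA : ∀ i j, f i ∈ A → g j ∈ A → M i j ≠ 0 ∧ ∀ z, lt' (f i) z → ¬ lt' z (g j))
    (hadjB : ∀ i j, f i ∈ B → g j ∈ B → M i j ≠ 0 ∧ ∀ z, lt' (f i) z → ¬ lt' z (g j))
    {j : κ} (hj : (∃ i, IsLow (fun i k => lt (f i) (f k)) (fun k => R k j) i ∧ f i ∈ A) ∨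
      g j ∈ A ∨ g j ∈ B ∨ ∀ i, f i ∉ B)
    {x : κ} (hx : U' x j ≠ 0) : U x j ≠ 0 := by
  by_cases hxj : x = j
  · rw [hxj, H.diag]
    exact one_ne_zero
  have hadj : ∀ i, M i j ≠ 0 → ¬ ∀ z, lt' (f i) z → ¬ lt' z (g j) := fun i hi h =>
    hxj (H'.eq_of_coeff_ne_zero_of_adjacent htrans' hc' (fun _ _ h => h) (fun _ _ h => h) hM' hi h
      hx)
  obtain ⟨k, hk', hsupp⟩ := H'.low_of_ne_zero x j hxj hx
  have hk := (hlow _ _).2 hk'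
  -- Unless both blocks contain rows, the row order is unchanged and T can be everything; a change
  -- in the column order does no harm.
  by_cases hrows : ∃ i₀ i₁, f i₀ ∈ A ∧ f i₁ ∈ B
  · obtain ⟨i₀, i₁, hi₀, hi₁⟩ := hrows
    rcases hj with ⟨i, hi, hiA⟩ | hj | hj | hj
    · obtain rfl := hA _ _ hi₀ hiA
      have h01 := swap _ hi₀ _ hi₁
      have hne : i₀ ≠ i₁ := fun h => hr.irrefl i₁ (h ▸ h01.1)
      -- A row after i₁ in the old order, or after i₀ in the new one, is neither of the two, so its
      -- comparisons with all rows survive.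
      have hkeep : ∀ k, lt (f i₁) (f k) ∨ lt' (f i₀) (f k) → ∀ l,
          (lt (f k) (f l) ↔ lt' (f k) (f l)) ∧ (lt (f i₁) (f k) ↔ lt' (f i₁) (f k)) := by
        intro k hk l
        have hk0 : k ≠ i₀ := by
          rintro rfl
          rcases hk with h | h
          · exact hr.asymm h h01.1
          · exact hr'.irrefl _ h
        have hk1 : k ≠ i₁ := by
          rintro rfl
          rcases hk with h | h
          · exact hr.irrefl _ h
          · exact hr'.asymm h h01.2
        exact ⟨keep _ _ (fun h => hk0 (hA _ _ h.1 hi₀)) fun h => hk1 (hB _ _ h.1 hi₁),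
          keep _ _ (fun h => hne (hA _ _ hi₀ h.1)) fun h => hk0 (hA _ _ h.2 hi₀)⟩
      have h0k := hsupp i₀ ((hlow _ _).1 hi).1
      have := (coeff_eq_and_column_eq hr hr' hc' H H' hlow {k | lt (f i₁) (f k)}
        (fun k hk l hkl => hr.trans _ _ _ hk hkl) (fun k hk l => (hkeep k (Or.inl hk) l).1) j).1 x k
        ((hkeep k (Or.inr h0k) k).2.2 (hr'.trans _ _ _ h01.2 h0k)) hk
      rwa [this]
    · obtain ⟨h1, h2⟩ := hadjA _ _ hi₀ hj
      exact (hadj _ h1 h2).elim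
    · obtain ⟨h1, h2⟩ := hadjB _ _ hi₁ hj
      exact (hadj _ h1 h2).elim
    · exact (hj _ hi₁).elim
  · have := (coeff_eq_and_column_eq hr hr' hc' H H' hlow Set.univ (fun _ _ _ _ => trivial)
      (fun k _ l => keep _ _ (fun h => hrows ⟨_, _, h⟩) fun h => hrows ⟨_, _, h.symm⟩) j).1 x k
      trivial hk
    rwa [this]

theorem reindex {ι κ κ' : Type*} [Fintype κ] [Fintype κ'] {r : ι → ι → Prop} {c : κ → κ → Prop}
    {M R : Matrix ι κ (ZMod 2)} {U : Matrix κ κ (ZMod 2)} (H : IsLazyReduction r c M R U)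
    (e : κ' ≃ κ) :
    IsLazyReduction r (fun x y => c (e x) (e y)) (fun i x => M i (e x)) (fun i x => R i (e x))
      (fun x y => U (e x) (e y)) where
  sum_eq := fun i y => by rw [← H.sum_eq, ← e.sum_comp]
  diag := fun y => H.diag _
  lt_of_ne_zero := fun x y hxy => H.lt_of_ne_zero _ _ (e.injective.ne hxy)
  low_of_ne_zero := fun x y hxy => H.low_of_ne_zero _ _ (e.injective.ne hxy)
  low_injective := fun x y i hx hy => e.injective (H.low_injective _ _ i hx hy)

end IsLazyReduction

/-! ### Orders, blocks and pairs of a discrete Morse function -/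

namespace LefschetzComplex

variable {X : Type*} [Fintype X] {K : LefschetzComplex X} {h h' : X → ℝ} {A B : Set X}

theorem hlt_irrefl (x : X) : ¬ K.hlt h x x := by
  rintro (h1 | h1)
  · exact lt_irrefl _ h1
  · exact lt_irrefl _ h1.2

theorem hlt_trans (x y z : X) (h₁ : K.hlt h x y) (h₂ : K.hlt h y z) : K.hlt h x z := by
  rcases h₁ with h1 | h1 <;> rcases h₂ with h2 | h2
  · exact Or.inl (h1.trans h2)
  · exact Or.inl (h2.1 ▸ h1)
  · exact Or.inl (h1.1 ▸ h2)
  · exact Or.inr ⟨h1.1.trans h2.1, h1.2.trans h2.2⟩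

theorem hlt_asymm {x y : X} (h₁ : K.hlt h x y) : ¬ K.hlt h y x := fun h₂ =>
  hlt_irrefl x (hlt_trans _ _ _ h₁ h₂)

theorem dim_succ_of_D_eq_one {x y : X} (hxy : K.D x y = 1) : K.dim x + 1 = K.dim y :=
  K.dim_of_ne_zero x y (by rw [hxy]; exact one_ne_zero)

theorem IsDiscreteMorse.hlt_of_ne_zero (hh : K.IsDiscreteMorse h) {x y : X} (hxy : K.D x y ≠ 0) :
    K.hlt h x y := by
  have := K.dim_of_ne_zero x y hxy
  rcases (hh.weakly_monotone x y (zmod_two_eq_one hxy)).lt_or_eq with h1 | h1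
  · exact Or.inl h1
  · exact Or.inr ⟨h1, by omega⟩

/-- A tie of h joins a facet to a cofacet, so distinct cells of equal dimension have distinct
values. -/
theorem IsDiscreteMorse.strictTotal (hh : K.IsDiscreteMorse h) {p : X → Prop}
    (hp : ∀ x y, p x → p y → K.dim x = K.dim y) :
    StrictTotal (fun x y : {x // p x} => K.hlt h x y) where
  irrefl := fun x => hlt_irrefl _
  trans := fun x y z => hlt_trans _ _ _
  total := fun x y => by
    rcases lt_trichotomy (h x) (h y) with h1 | h1 | h1
    · exact Or.inr (Or.inl (Or.inl h1))
    · left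
      by_contra hne
      have := hp x y x.2 y.2
      rcases hh.pairing x y (fun h => hne (Subtype.ext h)) h1 with h2 | h2 <;>
        have := dim_succ_of_D_eq_one h2 <;> omega
    · exact Or.inr (Or.inr (Or.inl h1))

theorem IsBlock.eq_of_dim_eq (hA : K.IsBlock h A) {x y : X} (hx : x ∈ A) (hy : y ∈ A)
    (hxy : K.dim x = K.dim y) : x = y := by
  rcases hA with ⟨a, rfl⟩ | ⟨a, b, hab, -, rfl⟩
  · exact hx.trans hy.symm
  · have := dim_succ_of_D_eq_one hab
    rcases hx with rfl | rfl <;> rcases hy with rfl | rfl <;> first | rfl | omega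

theorem IsBlock.vector_of_dim_lt (hA : K.IsBlock h A) {x y : X} (hx : x ∈ A) (hy : y ∈ A)
    (hxy : K.dim x < K.dim y) : K.D x y = 1 ∧ h x = h y := by
  rcases hA with ⟨a, rfl⟩ | ⟨a, b, hab, he, rfl⟩
  · rw [hx, hy] at hxy
    exact (lt_irrefl _ hxy).elim
  · have := dim_succ_of_D_eq_one hab
    rcases hx with rfl | rfl <;> rcases hy with rfl | rfl
    · omega
    · exact ⟨hab, he⟩
    · omega
    · omega

theorem IsBlock.not_between (hA : K.IsBlock h A) {x y z : X} (hx : x ∈ A) (hy : y ∈ A)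
    (hxy : K.dim x < K.dim y) (h₁ : K.hlt h x z) (h₂ : K.hlt h z y) : False := by
  obtain ⟨hD, he⟩ := hA.vector_of_dim_lt hx hy hxy
  have := dim_succ_of_D_eq_one hD
  rcases h₁ with h1 | h1 <;> rcases h₂ with h2 | h2
  · exact lt_irrefl _ (he ▸ h1.trans h2)
  · exact h1.ne (he.trans h2.1.symm)
  · exact h2.ne (h1.1.symm.trans he)
  · omega

namespace IsTransposition

variable (T : K.IsTransposition h h' A B)
include T

theorem disjoint {x : X} (hA : x ∈ A) (hB : x ∈ B) : False :=
  hlt_irrefl _ (T.swap x hA x hB).1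

theorem not_between_left {x y z : X} (hx : x ∈ A) (hy : y ∈ A) (hxy : K.dim x < K.dim y)
    (h₁ : K.hlt h' x z) (h₂ : K.hlt h' z y) : False := by
  by_cases hz : z ∈ B
  · exact hlt_asymm h₁ (T.swap x hx z hz).2
  · exact T.left_block.not_between hx hy hxy
      ((T.keep x z (fun h => hz h.2) fun h => T.disjoint hx h.1).2 h₁)
      ((T.keep z y (fun h => T.disjoint hy h.2) fun h => hz h.1).2 h₂)

theorem not_between_right {x y z : X} (hx : x ∈ B) (hy : y ∈ B) (hxy : K.dim x < K.dim y)
    (h₁ : K.hlt h' x z) (h₂ : K.hlt h' z y) : False := by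
  by_cases hz : z ∈ A
  · exact hlt_asymm h₂ (T.swap z hz y hy).2
  · exact T.right_block.not_between hx hy hxy
      ((T.keep x z (fun h => T.disjoint h.1 hx) fun h => hz h.2).2 h₁)
      ((T.keep z y (fun h => hz h.1) fun h => T.disjoint h.2 hy).2 h₂)

end IsTransposition

theorem isPaired_iff {n : ℕ} (i : {x // K.dim x + 1 = n}) (j : {y // K.dim y = n}) :
    K.IsPaired h i j ↔ IsLow (fun x y : {x // K.dim x + 1 = n} => K.hlt h x y)
      (fun r => (K.homReduction h n).1 r j) i := by
  constructor
  · rintro ⟨m, hb, hd, hlow⟩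
    obtain rfl : m = n := hd.symm.trans j.2
    exact hlow
  · intro hlow
    exact ⟨n, i.2, j.2, hlow⟩

theorem isPaired_iff_mem_bd {b d : X} : K.IsPaired h b d ↔ (b, some d) ∈ K.bd h := by
  simp [bd]

theorem IsDiscreteMorse.isLazyReduction_hom (hh : K.IsDiscreteMorse h) (n : ℕ) :
    IsLazyReduction (fun x y : {x // K.dim x + 1 = n} => K.hlt h x y)
      (fun x y : {y // K.dim y = n} => K.hlt h x y) (K.boundaryMatrix n)
      (K.homReduction h n).1 (K.homReduction h n).2 :=
  isLazyReduction_lazyReduction (hh.strictTotal fun x y _ _ => by omega)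
    (hh.strictTotal fun x y _ _ => by omega) _

theorem IsDiscreteMorse.isLazyReduction_cohom (hh : K.IsDiscreteMorse h) (n : ℕ) :
    IsLazyReduction (fun x y : {y // K.dim y = n + 1} => K.hlt h y x)
      (fun x y : {x // K.dim x = n} => K.hlt h y x) (K.coboundaryMatrix n)
      (K.cohomReduction h n).1 (K.cohomReduction h n).2 :=
  isLazyReduction_lazyReduction (hh.strictTotal fun x y _ _ => by omega).swap
    (hh.strictTotal fun x y _ _ => by omega).swap _

/-- The reductions of the boundary and of the coboundary matrix give the same pairs. -/
theorem IsDiscreteMorse.isPaired_iff_cohom (hh : K.IsDiscreteMorse h) {n : ℕ}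
    (i : {y // K.dim y = n + 1}) (j : {x // K.dim x = n}) :
    K.IsPaired h j i ↔ IsLow (fun x y : {y // K.dim y = n + 1} => K.hlt h y x)
      (fun r => (K.cohomReduction h n).1 r j) i := by
  -- Rows of the boundary matrix and columns of the coboundary matrix are the same cells, described
  -- by different subtypes.
  let e : {x // K.dim x + 1 = n + 1} ≃ {x // K.dim x = n} :=
    Equiv.subtypeEquivRight fun x => by omega
  have h1 := (hh.isLazyReduction_hom (n + 1)).isLow_transpose_iff
    (hh.strictTotal fun x y _ _ => by omega) (hh.strictTotal fun x y _ _ => by omega)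
    ((hh.isLazyReduction_cohom n).reindex e) (e.symm j) i
  exact (isPaired_iff (e.symm j) i).trans h1

/-! ### Coefficients of the two reductions under the transposition -/

variable (hh : K.IsDiscreteMorse h) (hh' : K.IsDiscreteMorse h')
  (T : K.IsTransposition h h' A B) (hpair : ∀ b d, K.IsPaired h b d ↔ K.IsPaired h' b d)
include hh hh' T hpair

theorem IsTransposition.homReduction_ne_zero {n : ℕ} {x c : {y // K.dim y = n}}
    (hc : (∃ b ∈ A, K.IsPaired h b c) ∨ c.1 ∈ A ∨ c.1 ∈ B ∨ ∀ b ∈ B, K.dim b + 1 ≠ n)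
    (hx : (K.homReduction h' n).2 x c ≠ 0) : (K.homReduction h n).2 x c ≠ 0 := by
  refine (hh.isLazyReduction_hom n).coeff_ne_zero_of_transposition (f := Subtype.val)
    (g := Subtype.val) (lt := K.hlt h) (lt' := K.hlt h') hlt_trans
    (hh.strictTotal fun x y _ _ => by omega) (hh'.strictTotal fun x y _ _ => by omega)
    (hh'.strictTotal fun x y _ _ => by omega) (hh'.isLazyReduction_hom n)
    (fun i j => hh'.hlt_of_ne_zero) (fun i j => ?_) T.swap T.keep
    (fun i k hi hk => Subtype.ext (T.left_block.eq_of_dim_eq hi hk (by omega)))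
    (fun i k hi hk => Subtype.ext (T.right_block.eq_of_dim_eq hi hk (by omega)))
    (fun i j hi hj => ?_) (fun i j hi hj => ?_) ?_ hx
  · rw [← isPaired_iff, ← isPaired_iff, hpair]
  · have hd : K.dim i < K.dim j := by omega
    refine ⟨?_, fun z => T.not_between_left hi hj hd⟩
    rw [boundaryMatrix, (T.left_block.vector_of_dim_lt hi hj hd).1]
    exact one_ne_zero
  · have hd : K.dim i < K.dim j := by omega
    refine ⟨?_, fun z => T.not_between_right hi hj hd⟩
    rw [boundaryMatrix, (T.right_block.vector_of_dim_lt hi hj hd).1]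
    exact one_ne_zero
  · rcases hc with ⟨b, hb, hbc⟩ | hc | hc | hc
    · have hbd : K.dim b + 1 = n := by
        obtain ⟨m, h1, h2, -⟩ := hbc
        exact h1.trans (h2.symm.trans c.2)
      exact Or.inl ⟨⟨b, hbd⟩, (isPaired_iff ⟨b, hbd⟩ c).1 hbc, hb⟩
    · exact Or.inr (Or.inl hc)
    · exact Or.inr (Or.inr (Or.inl hc))
    · exact Or.inr (Or.inr (Or.inr fun i hi => hc i hi i.2))

theorem IsTransposition.cohomReduction_ne_zero {n : ℕ} {x c : {y // K.dim y = n}}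
    (hc : (∃ d ∈ B, K.IsPaired h c d) ∨ c.1 ∈ B ∨ c.1 ∈ A ∨ ∀ d ∈ A, K.dim d ≠ n + 1)
    (hx : (K.cohomReduction h' n).2 x c ≠ 0) : (K.cohomReduction h n).2 x c ≠ 0 := by
  refine (hh.isLazyReduction_cohom n).coeff_ne_zero_of_transposition (f := Subtype.val)
    (g := Subtype.val) (A := B) (B := A) (lt := fun x y => K.hlt h y x)
    (lt' := fun x y => K.hlt h' y x) (fun x y z h₁ h₂ => hlt_trans _ _ _ h₂ h₁)
    (hh.strictTotal fun x y _ _ => by omega).swap (hh'.strictTotal fun x y _ _ => by omega).swap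
    (hh'.strictTotal fun x y _ _ => by omega).swap (hh'.isLazyReduction_cohom n)
    (fun i j => hh'.hlt_of_ne_zero) (fun i j => ?_) (fun b hb a ha => T.swap a ha b hb)
    (fun x y h₁ h₂ => T.keep y x (fun h => h₁ h.symm) (fun h => h₂ h.symm))
    (fun i k hi hk => Subtype.ext (T.right_block.eq_of_dim_eq hi hk (by omega)))
    (fun i k hi hk => Subtype.ext (T.left_block.eq_of_dim_eq hi hk (by omega)))
    (fun i j hi hj => ?_) (fun i j hi hj => ?_) ?_ hx
  · rw [← hh.isPaired_iff_cohom, ← hh'.isPaired_iff_cohom, hpair]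
  · have hd : K.dim j < K.dim i := by omega
    refine ⟨?_, fun z h₁ h₂ => T.not_between_right hj hi hd h₂ h₁⟩
    rw [coboundaryMatrix, (T.right_block.vector_of_dim_lt hj hi hd).1]
    exact one_ne_zero
  · have hd : K.dim j < K.dim i := by omega
    refine ⟨?_, fun z h₁ h₂ => T.not_between_left hj hi hd h₂ h₁⟩
    rw [coboundaryMatrix, (T.left_block.vector_of_dim_lt hj hi hd).1]
    exact one_ne_zero
  · rcases hc with ⟨d, hd, hcd⟩ | hc | hc | hc
    · have hdd : K.dim d = n + 1 := by
        obtain ⟨m, h1, h2, -⟩ := hcd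
        rw [h2, ← h1, c.2]
      exact Or.inl ⟨⟨d, hdd⟩, (hh.isPaired_iff_cohom ⟨d, hdd⟩ c).1 hcd, hd⟩
    · exact Or.inr (Or.inl hc)
    · exact Or.inr (Or.inr (Or.inl hc))
    · exact Or.inr (Or.inr (Or.inr fun i hi => hc i hi i.2))

end LefschetzComplex

theorem mainTheorem6 {X : Type*} [Fintype X] (K : LefschetzComplex X) (h h' : X → ℝ)
    (hh : K.IsDiscreteMorse h) (hh' : K.IsDiscreteMorse h') (A B : Set X)
    (htrans : K.IsTransposition h h' A B)
    (hnoswitch : K.bd h' = K.bd h)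
    (α : X × Option X) (hα : α ∈ K.bd h)
    (hmove : α.1 ∈ A ∨ ∃ d ∈ B, α.2 = some d)
    (β : X × Option X) (hβ : β ∈ K.bd h) :
    (K.PairHomRel h' β α → K.PairHomRel h β α) ∧
      (K.PairCohomRel h' β α → K.PairCohomRel h β α) := by
  have hpair : ∀ b d, K.IsPaired h b d ↔ K.IsPaired h' b d := fun b d => by
    rw [LefschetzComplex.isPaired_iff_mem_bd, LefschetzComplex.isPaired_iff_mem_bd, hnoswitch]
  have hαpair : ∀ d, α.2 = some d → K.IsPaired h α.1 d := by
    intro d hd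
    rcases hα with ⟨d', hd', hp⟩ | ⟨hn, -⟩
    · obtain rfl : d = d' := Option.some.inj (hd.symm.trans hd')
      exact hp
    · rw [hn] at hd
      cases hd
  have hdim : ∀ d, α.2 = some d → K.dim α.1 + 1 = K.dim d := by
    intro d hd
    obtain ⟨n, h1, h2, -⟩ := hαpair d hd
    exact h1.trans h2.symm
  constructor
  · rintro ⟨d, hd, c, hc, n, hx, hy, hU⟩
    refine ⟨d, hd, c, hc, n, hx, hy, zmod_two_eq_one
      (htrans.homReduction_ne_zero hh hh' hpair ?_ (by rw [hU]; exact one_ne_zero))⟩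
    rcases hc with rfl | hc <;> rcases hmove with hm | ⟨d', hd', hα'⟩
    · exact Or.inr (Or.inl hm)
    -- A cell of dimension n - 1 in B, next to the death cell of dimension n + 1, would contradict
    -- that a block spans at most two consecutive dimensions.
    · refine Or.inr (Or.inr (Or.inr fun b hb hbn => ?_))
      have hb' := hdim d' hα'
      have := LefschetzComplex.dim_succ_of_D_eq_one
        (htrans.right_block.vector_of_dim_lt hb hd' (by omega)).1
      omega
    · exact Or.inl ⟨_, hm, hαpair c hc⟩
    · obtain rfl : c = d' := Option.some.inj (hc.symm.trans hα')
      exact Or.inr (Or.inr (Or.inl hd'))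
  · rintro ⟨c, hc, n, hx, hy, hU⟩
    refine ⟨c, hc, n, hx, hy, zmod_two_eq_one
      (htrans.cohomReduction_ne_zero hh hh' hpair ?_ (by rw [hU]; exact one_ne_zero))⟩
    rcases hc with rfl | hc <;> rcases hmove with hm | ⟨d', hd', hα'⟩
    · exact Or.inr (Or.inr (Or.inl hm))
    · exact Or.inl ⟨d', hd', hαpair d' hα'⟩
    -- Dually, A contains the birth cell of dimension n - 1, hence no cell of dimension n + 1.
    · refine Or.inr (Or.inr (Or.inr fun d' hd' hdn => ?_))
      have hb' := hdim c hc
      have := LefschetzComplex.dim_succ_of_D_eq_one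
        (htrans.left_block.vector_of_dim_lt hm hd' (by omega)).1
      omega
    · obtain rfl : c = d' := Option.some.inj (hc.symm.trans hα')
      exact Or.inr (Or.inl hd')
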